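/- Let $S$ be a finite set and, for each $\lambda>0$, let $Q(\lambda)=(q_{ij}(\lambda))$ be an irreducible transition rate matrix on $S$ (that is, $q_{ij}(\lambda)\ge 0$ for $i\ne j$ and every row sums to $0$). Put $q_i(\lambda)=-q_{ii}(\lambda)$, and let $\Omega(\lambda)=(\omega_{ij}(\lambda))$ be the transition matrix of the jump chain: $\omega_{ij}(\lambda)=q_{ij}(\lambda)/q_i(\lambda)$ for $i\ne j$ and $\omega_{ii}(\lambda)=0$. Assume that for all $i\neq j$, as $\lambda\to\infty$, $q_{ij}(\lambda)$ either converges to a finite limit or tends to $\infty$, and that $\Omega(\lambda)$ converges to a matrix $\Omega$. Let $A$ be the set of fast states, those $i$ with $q_i:=\lim_{\lambda\to\infty}q_i(\lambda)=\infty$, and let $B$ be the set of slow states, those with $q_i<\infty$. Assume that $B\neq\emptyset$, that $q_i>0$ for every $i\in B$, and that the discrete-time Markov chain with transition matrix $\Omega$ started at any $i\in A$ reaches $B$ in finite time with probability $1$. Write $\Omega_{AA}$ and $\Omega_{AB}$ for the blocks of $\Omega$ with rows in $A$ and with columns in $A$ and $B$, respectively. Let $\pi=(\pi_A,\pi_B)$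 be a probability distribution on $S$. Then $I-\Omega_{AA}$ is invertible, and $$\gamma(\pi)=\pi_B+\pi_A(I-\Omega_{AA})^{-1}\Omega_{AB},$$ extended by $0$ to $A$, is a probability distribution on $S$. For every $\varepsilon>0$ there are times $t(\lambda,\varepsilon)>0$ $(\lambda>0)$ with $\lim_{\lambda\to\infty}t(\lambda,\varepsilon)=0$ such that for all sufficiently large $\lambda$, $$d_{TV}\bigl(P^\lambda_\pi(X_{t(\lambda,\varepsilon)}\in\cdot),\gamma(\pi)\bigr)\le\varepsilon ,$$ where under $P^\lambda_\pi$ the process $X$ is a continuous-time Markov chain on $S$ with transition rate matrix $Q(\lambda)$ and initial distribution $\pi$, and $d_{TV}(\mu,\nu)=\frac12\sum_{i\in S}|\mu_i-\nu_i|$ for probability distributions $\mu$ and $\nu$ on $S$. -/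

import Mathlib

open Filter Topology MeasureTheory
open scoped NNReal

/-- A transition rate matrix (`Q`-matrix) on a finite state space: the off-diagonal
entries are nonnegative and every row sums to zero. -/
structure IsRateMatrix {S : Type*} [Fintype S] (Q : Matrix S S ℝ) : Prop where
  nonneg_of_ne : ∀ i j, i ≠ j → 0 ≤ Q i j
  row_sum : ∀ i, ∑ j, Q i j = 0

/-- Irreducibility of a transition rate matrix: every state leads to every other state along
transitions of positive rate. -/
def IsIrreducibleRate {S : Type*} (Q : Matrix S S ℝ) : Prop :=
  ∀ i j, Relation.ReflTransGen (fun a b => a ≠ b ∧ 0 < Q a b) i j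

/-- The total rate `q_i = -q_{ii}` at which the chain leaves the state `i`. -/
def exitRate {S : Type*} (Q : Matrix S S ℝ) (i : S) : ℝ := -Q i i

/-- The transition matrix of the jump chain: `ω_{ij} = q_{ij} / q_i` for `i ≠ j`, and
`ω_{ii} = 0`. -/
noncomputable def jumpMatrix {S : Type*} [DecidableEq S] (Q : Matrix S S ℝ) : Matrix S S ℝ :=
  Matrix.of fun i j => if i = j then 0 else Q i j / exitRate Q i

open scoped Classical in
/-- The fast states: those with `q_i(l) → ∞` as `l → ∞`. -/
noncomputable def fastStates {S : Type*} [Fintype S] (Q : ℝ → Matrix S S ℝ) : Finset S :=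
  Finset.univ.filter fun i => Tendsto (fun l => exitRate (Q l) i) atTop atTop

open scoped Classical in
/-- The slow states: those for which `q_i(l)` has a finite limit as `l → ∞`. -/
noncomputable def slowStates {S : Type*} [Fintype S] (Q : ℝ → Matrix S S ℝ) : Finset S :=
  Finset.univ.filter fun i => ∃ c : ℝ, Tendsto (fun l => exitRate (Q l) i) atTop (𝓝 c)

/-- The block of the matrix `M` with rows in `A` and columns in `B`. -/
def block {S : Type*} (M : Matrix S S ℝ) (A B : Finset S) : Matrix A B ℝ :=
  M.submatrix Subtype.val Subtype.val

/-- `γ(π) = π_B + π_A (I - Ω_AA)⁻¹ Ω_AB`, regarded as a vector on the whole state space that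
vanishes outside `B`. -/
noncomputable def gammaDist {S : Type*} [DecidableEq S] (Ω : Matrix S S ℝ) (A B : Finset S)
    (π : S → ℝ) : S → ℝ := fun j =>
  if h : j ∈ B then
    π j + Matrix.vecMul (fun i : A => π i) ((1 - block Ω A A)⁻¹ * block Ω A B) ⟨j, h⟩
  else 0

/-- Under the probability measure `P`, the process `η` is a discrete-time Markov chain with
transition matrix `W` and initial distribution `π`. -/
structure IsDiscreteMarkovChain {S E : Type*} [MeasurableSpace E]
    (P : Measure E) (η : ℕ → E → S) (W : Matrix S S ℝ) (π : S → ℝ) : Prop where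
  isProbabilityMeasure : IsProbabilityMeasure P
  measurableSet_preimage : ∀ n i, MeasurableSet (η n ⁻¹' {i})
  measure_path : ∀ (n : ℕ) (i : Fin (n + 1) → S),
    P.real {x | ∀ k : Fin (n + 1), η k x = i k} =
      π (i 0) * ∏ k : Fin n, W (i k.castSucc) (i k.succ)

/-- The first-passage time `inf {n ≥ 0 : η_n ∈ B}`, equal to `⊤` if `B` is never reached. -/
noncomputable def firstPassageTime {S E : Type*} (η : ℕ → E → S) (B : Finset S) (x : E) : ℕ∞ :=
  ⨅ (n : ℕ) (_ : η n x ∈ B), (n : ℕ∞)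

/-- Under the probability measure `P`, the process `X` is a continuous-time Markov chain with
transition rate matrix `Q` and initial distribution `π`: its finite-dimensional distributions
are those given by `π` and the transition semigroup `exp (t Q)`. No regularity of the paths is
asked for, so chains with right-continuous paths are a special case. -/
structure IsMarkovChain {S E : Type*} [Fintype S] [DecidableEq S] [MeasurableSpace E]
    (P : Measure E) (X : ℝ≥0 → E → S) (Q : Matrix S S ℝ) (π : S → ℝ) : Prop where
  isProbabilityMeasure : IsProbabilityMeasure P
  measurableSet_preimage : ∀ t i, MeasurableSet (X t ⁻¹' {i})
  measure_path : ∀ (n : ℕ) (t : Fin (n + 1) → ℝ≥0), Monotone t → t 0 = 0 →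
    ∀ i : Fin (n + 1) → S,
      P.real {x | ∀ k : Fin (n + 1), X (t k) x = i k} =
        π (i 0) * ∏ k : Fin n,
          NormedSpace.exp (((t k.succ : ℝ) - (t k.castSucc : ℝ)) • Q) (i k.castSucc) (i k.succ)

/-- The distribution on `S` of a random variable `Z`, as a vector of point probabilities. -/
noncomputable def law {S E : Type*} [MeasurableSpace E] (P : Measure E) (Z : E → S) : S → ℝ :=
  fun i => P.real (Z ⁻¹' {i})

/-- The total variation distance of two distributions on a finite set. -/
noncomputable def dTV {S : Type*} [Fintype S] (μ ν : S → ℝ) : ℝ :=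
  (1 / 2) * ∑ i, |μ i - ν i|

section Semigroup

variable {S : Type*} [Fintype S] [DecidableEq S]

theorem Matrix.exp_apply_nonneg {M : Matrix S S ℝ} (hM : ∀ i j, 0 ≤ M i j) (i j : S) :
    0 ≤ NormedSpace.exp M i j := by
  let _ : NormedRing (Matrix S S ℝ) := Matrix.linftyOpNormedRing
  let _ : NormedAlgebra ℝ (Matrix S S ℝ) := Matrix.linftyOpNormedAlgebra
  have h := NormedSpace.exp_series_hasSum_exp' (𝕂 := ℝ) M
  have h2 : HasSum (fun n : ℕ => ((n.factorial : ℝ)⁻¹ • M ^ n) i j) (NormedSpace.exp M i j) :=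
    h.map ((Pi.evalAddMonoidHom (fun _ : S => ℝ) j).comp
      (Pi.evalAddMonoidHom (fun _ : S => S → ℝ) i))
      ((continuous_apply j).comp (continuous_apply i))
  exact h2.nonneg fun n => mul_nonneg (by positivity) (Matrix.pow_apply_nonneg hM n i j)

theorem Matrix.hasDerivAt_exp_smul_mulVec (Q : Matrix S S ℝ) (g : S → ℝ) (i : S) (t : ℝ) :
    HasDerivAt (fun s : ℝ => (NormedSpace.exp (s • Q)).mulVec g i)
      ((NormedSpace.exp (t • Q)).mulVec (Q.mulVec g) i) t := by
  let _ : NormedRing (Matrix S S ℝ) := Matrix.linftyOpNormedRing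
  let _ : NormedAlgebra ℝ (Matrix S S ℝ) := Matrix.linftyOpNormedAlgebra
  have h := hasDerivAt_exp_smul_const (𝕂 := ℝ) Q t
  let φ : Matrix S S ℝ →ₗ[ℝ] ℝ :=
    { toFun := fun M => M.mulVec g i
      map_add' := fun M N => by simp [Matrix.add_mulVec]
      map_smul' := fun c M => by simp [Matrix.smul_mulVec] }
  have h2 := φ.toContinuousLinearMap.hasFDerivAt.comp_hasDerivAt t h
  rw [Matrix.mulVec_mulVec]
  exact h2

namespace IsRateMatrix

variable {Q : Matrix S S ℝ}

theorem exp_apply_nonneg (hQ : IsRateMatrix Q) {t : ℝ} (ht : 0 ≤ t) (i j : S) :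
    0 ≤ NormedSpace.exp (t • Q) i j := by
  obtain ⟨c, hc⟩ : ∃ c : ℝ, ∀ i, -c ≤ Q i i := by
    refine ⟨∑ k, |Q k k|, fun i => ?_⟩
    have := Finset.single_le_sum (f := fun k => |Q k k|) (fun k _ => abs_nonneg _)
      (Finset.mem_univ i)
    linarith [neg_abs_le (Q i i)]
  have hcomm : Commute (Matrix.diagonal fun _ : S => -(t * c)) (t • Q + (t * c) • 1) := by
    rw [← Matrix.smul_one_eq_diagonal]
    exact (Commute.one_left _).smul_left _
  have hexp := Matrix.exp_add_of_commute _ _ hcomm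
  have hsum : (Matrix.diagonal fun _ : S => -(t * c)) + (t • Q + (t * c) • 1) = t • Q := by
    rw [← Matrix.smul_one_eq_diagonal, neg_smul]; abel
  rw [hsum, Matrix.exp_diagonal] at hexp
  rw [hexp, Matrix.diagonal_mul, Pi.coe_exp, ← Real.exp_eq_exp_ℝ]
  refine mul_nonneg (Real.exp_pos _).le (Matrix.exp_apply_nonneg (fun a b => ?_) i j)
  by_cases h : a = b
  · subst h
    simp only [Matrix.add_apply, Matrix.smul_apply, Matrix.one_apply_eq, smul_eq_mul, mul_one]
    nlinarith [hc a]
  · simpa [Matrix.one_apply_ne h] using mul_nonneg ht (hQ.nonneg_of_ne a b h)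

theorem exp_mulVec_mono (hQ : IsRateMatrix Q) {t : ℝ} (ht : 0 ≤ t) {f g : S → ℝ}
    (hfg : ∀ i, f i ≤ g i) (i : S) :
    (NormedSpace.exp (t • Q)).mulVec f i ≤ (NormedSpace.exp (t • Q)).mulVec g i :=
  Finset.sum_le_sum fun j _ => mul_le_mul_of_nonneg_left (hfg j) (hQ.exp_apply_nonneg ht i j)

theorem exp_mulVec_const (hQ : IsRateMatrix Q) (t c : ℝ) (i : S) :
    (NormedSpace.exp (t • Q)).mulVec (fun _ => c) i = c := by
  have h0 : Q.mulVec (fun _ => c) = 0 := by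
    ext k
    simp [Matrix.mulVec, dotProduct, ← Finset.sum_mul, hQ.row_sum k]
  have hd := fun s => Matrix.hasDerivAt_exp_smul_mulVec Q (fun _ => c) i s
  have := is_const_of_deriv_eq_zero (fun s => (hd s).differentiableAt)
    (fun s => by rw [(hd s).deriv, h0, Matrix.mulVec_zero]; rfl) t 0
  simpa using this

/-- If `Q w ≤ C - K w`, then `exp (t Q) w ≤ exp (-K t) w + C / K`. -/
theorem exp_mulVec_le_of_drift (hQ : IsRateMatrix Q) {w : S → ℝ} {C K : ℝ} (hC : 0 ≤ C)
    (hK : 0 < K) (hw : ∀ i, Q.mulVec w i ≤ C - K * w i) {t : ℝ} (ht : 0 ≤ t) (i : S) :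
    (NormedSpace.exp (t • Q)).mulVec w i ≤ Real.exp (-(K * t)) * w i + C / K := by
  let φ : ℝ → ℝ := fun s =>
    Real.exp (K * s) * ((NormedSpace.exp (s • Q)).mulVec w i - C / K)
  have hd : ∀ s, HasDerivAt φ (Real.exp (K * s) * K *
      ((NormedSpace.exp (s • Q)).mulVec w i - C / K) +
      Real.exp (K * s) * (NormedSpace.exp (s • Q)).mulVec (Q.mulVec w) i) s := by
    intro s
    have h1 : HasDerivAt (fun s => Real.exp (K * s)) (Real.exp (K * s) * K) s := by
      simpa using ((hasDerivAt_id s).const_mul K).exp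
    exact h1.mul ((Matrix.hasDerivAt_exp_smul_mulVec Q w i s).sub_const _)
  have hanti : AntitoneOn φ (Set.Ici 0) := by
    refine antitoneOn_of_deriv_nonpos (convex_Ici 0)
      (fun s _ => (hd s).continuousAt.continuousWithinAt)
      (fun s _ => (hd s).differentiableAt.differentiableWithinAt) fun s hs => ?_
    rw [interior_Ici] at hs
    rw [(hd s).deriv]
    have h1 := hQ.exp_mulVec_mono (le_of_lt hs) hw i
    have h2 : (NormedSpace.exp (s • Q)).mulVec (fun k => C - K * w k) i
        = C - K * (NormedSpace.exp (s • Q)).mulVec w i := by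
      have : (fun k => C - K * w k) = (fun _ => C) - K • w := by ext; simp
      rw [this, Matrix.mulVec_sub, Pi.sub_apply, hQ.exp_mulVec_const, Matrix.mulVec_smul]
      simp
    rw [h2] at h1
    have h3 : K * (C / K) = C := by field_simp
    have : Real.exp (K * s) * (K * ((NormedSpace.exp (s • Q)).mulVec w i - C / K) +
        (NormedSpace.exp (s • Q)).mulVec (Q.mulVec w) i) ≤ 0 :=
      mul_nonpos_of_nonneg_of_nonpos (Real.exp_pos _).le (by rw [mul_sub, h3]; linarith)
    linarith
  have h := hanti (Set.mem_Ici.2 le_rfl) (Set.mem_Ici.2 ht) ht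
  simp only [φ, mul_zero, Real.exp_zero, one_mul, zero_smul, NormedSpace.exp_zero,
    Matrix.one_mulVec] at h
  have h5 : (NormedSpace.exp (t • Q)).mulVec w i - C / K
      = Real.exp (-(K * t)) *
        (Real.exp (K * t) * ((NormedSpace.exp (t • Q)).mulVec w i - C / K)) := by
    rw [← mul_assoc, ← Real.exp_add]; simp
  have h6 := mul_le_mul_of_nonneg_left h (Real.exp_pos (-(K * t))).le
  have h7 : 0 ≤ Real.exp (-(K * t)) * (C / K) := by positivity
  rw [← h5, mul_sub] at h6
  linarith

/-- If `Q g ≤ C`, then `exp (t Q) g ≤ g + C t`. -/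
theorem exp_mulVec_le_of_le (hQ : IsRateMatrix Q) {g : S → ℝ} {C : ℝ}
    (hg : ∀ i, Q.mulVec g i ≤ C) {t : ℝ} (ht : 0 ≤ t) (i : S) :
    (NormedSpace.exp (t • Q)).mulVec g i ≤ g i + C * t := by
  have hd : ∀ s, HasDerivAt (fun s : ℝ => (NormedSpace.exp (s • Q)).mulVec g i - C * s)
      ((NormedSpace.exp (s • Q)).mulVec (Q.mulVec g) i - C) s := by
    intro s
    have h1 : HasDerivAt (fun s => C * s) C s := by simpa using (hasDerivAt_id s).const_mul C
    exact (Matrix.hasDerivAt_exp_smul_mulVec Q g i s).sub h1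
  have hanti : AntitoneOn (fun s : ℝ => (NormedSpace.exp (s • Q)).mulVec g i - C * s)
      (Set.Ici 0) := by
    refine antitoneOn_of_deriv_nonpos (convex_Ici 0)
      (fun s _ => (hd s).continuousAt.continuousWithinAt)
      (fun s _ => (hd s).differentiableAt.differentiableWithinAt) fun s hs => ?_
    rw [interior_Ici] at hs
    rw [(hd s).deriv]
    have h1 := hQ.exp_mulVec_mono (le_of_lt hs) hg i
    rw [hQ.exp_mulVec_const] at h1
    linarith
  have h := hanti (Set.mem_Ici.2 le_rfl) (Set.mem_Ici.2 ht) ht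
  simp at h
  linarith

end IsRateMatrix

end Semigroup

section Absorption

/-- The probability that a chain started in `i` spends the times `0, …, n` in `A`. -/
theorem IsDiscreteMarkovChain.measureReal_forall_mem {S E : Type*}
    [MeasurableSpace E] {P : Measure E} {η : ℕ → E → S} {W : Matrix S S ℝ} {π : S → ℝ} (h : IsDiscreteMarkovChain P η W π)
    (n : ℕ) (A : Finset S) :
    P.real {x | ∀ k : Fin (n + 1), η k x ∈ A} =
      ∑ a : Fin (n + 1) → A, π (a 0) * ∏ k : Fin n, W (a k.castSucc) (a k.succ) := by
  have := h.isProbabilityMeasure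
  have hset : {x | ∀ k : Fin (n + 1), η k x ∈ A} =
      ⋃ a ∈ (Finset.univ : Finset (Fin (n + 1) → A)),
        {x | ∀ k : Fin (n + 1), η k x = (a k : S)} := by
    ext x
    simp only [Set.mem_ofPred_eq, Finset.mem_univ, Set.iUnion_true, Set.mem_iUnion]
    exact ⟨fun hx => ⟨fun k => ⟨_, hx k⟩, fun k => rfl⟩, fun ⟨a, ha⟩ k => ha k ▸ (a k).2⟩
  rw [hset, measureReal_biUnion_finset]
  · exact Finset.sum_congr rfl fun a _ => h.measure_path n fun k => (a k : S)
  · intro a _ b _ hab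
    refine Set.disjoint_left.2 fun x hx hy => hab ?_
    ext k
    exact (hx k).symm.trans (hy k)
  · intro a _
    rw [Set.ofPred_forall]
    exact MeasurableSet.iInter fun k => h.measurableSet_preimage k (a k)

theorem Matrix.pow_mulVec_one_eq_sum_paths {T : Type*} [Fintype T] [DecidableEq T]
    (M : Matrix T T ℝ) (n : ℕ) (i : T) :
    (M ^ n).mulVec 1 i = ∑ a : Fin (n + 1) → T,
      (Pi.single i 1 : T → ℝ) (a 0) * ∏ k : Fin n, M (a k.castSucc) (a k.succ) := by
  induction n generalizing i with
  | zero =>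
    rw [Fintype.sum_equiv (Equiv.funUnique (Fin 1) T) _ (fun j => (Pi.single i 1 : T → ℝ) j)
      (fun a => by simp)]
    simp
  | succ n ih =>
    have hcons : ∑ a : Fin (n + 2) → T,
        (Pi.single i 1 : T → ℝ) (a 0) * ∏ k : Fin (n + 1), M (a k.castSucc) (a k.succ) =
        ∑ a : Fin (n + 1) → T, M i (a 0) * ∏ k : Fin n, M (a k.castSucc) (a k.succ) := by
      rw [← (Fin.consEquiv fun _ : Fin (n + 2) => T).sum_comp, Fintype.sum_prod_type,
        Finset.sum_eq_single i]
      · simp [Fin.consEquiv, Fin.prod_univ_succ (n := n)]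
      · intro b _ hb
        simp [Fin.consEquiv, hb]
      · simp
    rw [hcons, pow_succ', ← Matrix.mulVec_mulVec, Matrix.mulVec, dotProduct]
    simp_rw [ih, Finset.mul_sum]
    rw [Finset.sum_comm]
    refine Finset.sum_congr rfl fun a _ => ?_
    rw [Finset.sum_eq_single (a 0)]
    · simp
    · intro b _ hb
      simp [hb.symm]
    · simp

theorem IsDiscreteMarkovChain.tendsto_block_pow_mulVec_one {S E : Type*}
    [DecidableEq S] [MeasurableSpace E]
    {P : Measure E} {η : ℕ → E → S} {W : Matrix S S ℝ} {A B : Finset S} (i : A)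
    (h : IsDiscreteMarkovChain P η W (Pi.single (i : S) 1)) (hAB : Disjoint A B)
    (hT : ∀ᵐ x ∂P, firstPassageTime η B x < ⊤) :
    Tendsto (fun n : ℕ => (block W A A ^ n).mulVec 1 i) atTop (𝓝 0) := by
  have := h.isProbabilityMeasure
  let s : ℕ → Set E := fun n => {x | ∀ k : Fin (n + 1), η k x ∈ A}
  have hs : ∀ n, MeasurableSet (s n) := by
    intro n
    have : s n = ⋂ k : Fin (n + 1), ⋃ a : A, η k ⁻¹' {(a : S)} := by
      ext x; simp [s]
    rw [this]
    exact MeasurableSet.iInter fun k => MeasurableSet.iUnion fun a =>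
      h.measurableSet_preimage k a
  have hanti : Antitone s := fun m n hmn x hx k =>
    hx ⟨k, k.2.trans_le (by omega)⟩
  have hzero : P (⋂ n, s n) = 0 := by
    refine measure_mono_null (fun x hx => ?_) (ae_iff.1 hT)
    have hx' : ∀ n, η n x ∈ A := fun n => Set.mem_iInter.1 hx n (Fin.last n)
    simp only [Set.mem_ofPred_eq, not_lt, top_le_iff, firstPassageTime]
    refine iInf_eq_top.2 fun n => iInf_eq_top.2 fun hn => ?_
    exact absurd hn (Finset.disjoint_left.1 hAB (hx' n))
  have ht := tendsto_measure_iInter_atTop (μ := P) (fun n => (hs n).nullMeasurableSet) hanti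
    ⟨0, measure_ne_top P _⟩
  rw [hzero] at ht
  have hr := (ENNReal.tendsto_toReal ENNReal.zero_ne_top).comp ht
  refine hr.congr fun n => ?_
  have hp := h.measureReal_forall_mem n A
  rw [Matrix.pow_mulVec_one_eq_sum_paths]
  refine hp.trans (Finset.sum_congr rfl fun a _ => ?_)
  simp only [Pi.single_apply, block, Subtype.ext_iff, Matrix.submatrix_apply]

namespace Matrix

variable {T : Type*} [Fintype T] [DecidableEq T] {M : Matrix T T ℝ}

theorem tendsto_pow_of_mulVec_one (hM : ∀ i j, 0 ≤ M i j)
    (h : ∀ i, Tendsto (fun n : ℕ => (M ^ n).mulVec 1 i) atTop (𝓝 0)) :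
    Tendsto (fun n : ℕ => M ^ n) atTop (𝓝 0) := by
  refine tendsto_pi_nhds.2 fun i => tendsto_pi_nhds.2 fun j => ?_
  refine squeeze_zero (fun n => pow_apply_nonneg hM n i j) (fun n => ?_) (h i)
  simp only [mulVec, dotProduct, Pi.one_apply, mul_one]
  exact Finset.single_le_sum (f := fun j => (M ^ n) i j)
    (fun k _ => pow_apply_nonneg hM n i k) (Finset.mem_univ j)

theorem isUnit_one_sub_of_tendsto_pow (h : Tendsto (fun n : ℕ => M ^ n) atTop (𝓝 0)) :
    IsUnit (1 - M) := by
  rw [← mulVec_injective_iff_isUnit]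
  refine (injective_iff_map_eq_zero (1 - M).mulVecLin).2 fun v hv => ?_
  have hv' : M *ᵥ v = v := by
    have : v - M *ᵥ v = 0 := by simpa [sub_mulVec] using hv
    exact (sub_eq_zero.1 this).symm
  have hn : ∀ n : ℕ, (M ^ n) *ᵥ v = v := by
    intro n
    induction n with
    | zero => simp
    | succ n ih => rw [pow_succ, ← mulVec_mulVec, hv', ih]
  have ht : Tendsto (fun n : ℕ => (M ^ n) *ᵥ v) atTop (𝓝 (0 *ᵥ v)) :=
    ((continuous_id.matrix_mulVec continuous_const).tendsto 0).comp h
  simp only [hn, zero_mulVec] at ht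
  exact tendsto_nhds_unique tendsto_const_nhds ht

/-- The Neumann series bounds `(1 - M)⁻¹` from below by the identity. -/
theorem one_apply_le_inv_one_sub (hM : ∀ i j, 0 ≤ M i j)
    (h : Tendsto (fun n : ℕ => M ^ n) atTop (𝓝 0)) (i j : T) :
    (1 : Matrix T T ℝ) i j ≤ (1 - M)⁻¹ i j := by
  have hu := (isUnit_iff_isUnit_det _).1 (isUnit_one_sub_of_tendsto_pow h)
  have hsum : ∀ n : ℕ, ∑ k ∈ Finset.range n, M ^ k = (1 - M)⁻¹ * (1 - M ^ n) := by
    intro n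
    rw [← mul_neg_geom_sum M n, nonsing_inv_mul_cancel_left _ _ hu]
  have ht : Tendsto (fun n : ℕ => (1 - M)⁻¹ * (1 - M ^ n)) atTop
      (𝓝 ((1 - M)⁻¹ * (1 - 0))) :=
    ((continuous_const.matrix_mul (continuous_const.sub continuous_id)).tendsto
      (0 : Matrix T T ℝ)).comp h
  rw [sub_zero, mul_one] at ht
  have hij := tendsto_pi_nhds.1 (tendsto_pi_nhds.1 ht i) j
  refine ge_of_tendsto hij (eventually_atTop.2 ⟨1, fun n hn => ?_⟩)
  rw [← hsum n, sum_apply]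
  have := Finset.single_le_sum (f := fun k => (M ^ k) i j)
    (fun k _ => pow_apply_nonneg hM k i j) (Finset.mem_range.2 (show 0 < n from hn))
  simpa using this

end Matrix

end Absorption

section Rates

variable {S : Type*} [Fintype S]

theorem mem_fastStates {Q : ℝ → Matrix S S ℝ} {i : S} :
    i ∈ fastStates Q ↔ Tendsto (fun l => exitRate (Q l) i) atTop atTop := by
  simp [fastStates]

theorem mem_slowStates {Q : ℝ → Matrix S S ℝ} {i : S} :
    i ∈ slowStates Q ↔ ∃ c : ℝ, Tendsto (fun l => exitRate (Q l) i) atTop (𝓝 c) := by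
  simp [slowStates]

theorem disjoint_fastStates_slowStates (Q : ℝ → Matrix S S ℝ) :
    Disjoint (fastStates Q) (slowStates Q) := by
  refine Finset.disjoint_left.2 fun i hA hB => ?_
  obtain ⟨c, hc⟩ := mem_slowStates.1 hB
  exact not_tendsto_nhds_of_tendsto_atTop (mem_fastStates.1 hA) c hc

theorem exists_eventually_exitRate_le (Q : ℝ → Matrix S S ℝ) :
    ∃ C : ℝ, 0 ≤ C ∧ ∀ᶠ l in atTop, ∀ i ∈ slowStates Q, exitRate (Q l) i ≤ C := by
  have h : ∀ i : S, ∃ c : ℝ, i ∈ slowStates Q → ∀ᶠ l in atTop, exitRate (Q l) i ≤ c := by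
    intro i
    by_cases hi : i ∈ slowStates Q
    · obtain ⟨c, hc⟩ := mem_slowStates.1 hi
      exact ⟨c + 1, fun _ => hc.eventually_le_const (by linarith)⟩
    · exact ⟨0, fun h => absurd h hi⟩
  choose c hc using h
  refine ⟨∑ i, |c i|, Finset.sum_nonneg fun i _ => abs_nonneg _, ?_⟩
  refine (Finset.eventually_all (slowStates Q)).2 fun i hi => ?_
  filter_upwards [hc i hi] with l hl
  exact hl.trans ((le_abs_self _).trans
    (Finset.single_le_sum (f := fun i => |c i|) (fun i _ => abs_nonneg _) (Finset.mem_univ i)))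

variable [DecidableEq S]

namespace IsRateMatrix

variable {Q : Matrix S S ℝ}

theorem exitRate_eq_sum (hQ : IsRateMatrix Q) (i : S) :
    exitRate Q i = ∑ j ∈ Finset.univ.erase i, Q i j := by
  have h := hQ.row_sum i
  rw [← Finset.add_sum_erase _ _ (Finset.mem_univ i)] at h
  rw [exitRate]
  linarith

theorem exitRate_nonneg (hQ : IsRateMatrix Q) (i : S) : 0 ≤ exitRate Q i := by
  rw [hQ.exitRate_eq_sum]
  exact Finset.sum_nonneg fun j hj => hQ.nonneg_of_ne i j (Finset.ne_of_mem_erase hj).symm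

theorem abs_apply_le_exitRate (hQ : IsRateMatrix Q) (i j : S) : |Q i j| ≤ exitRate Q i := by
  by_cases h : i = j
  · subst h
    rw [← abs_neg, show -Q i i = exitRate Q i from rfl, abs_of_nonneg (hQ.exitRate_nonneg i)]
  · rw [abs_of_nonneg (hQ.nonneg_of_ne i j h), hQ.exitRate_eq_sum]
    exact Finset.single_le_sum (f := fun j => Q i j)
      (fun k hk => hQ.nonneg_of_ne i k (Finset.ne_of_mem_erase hk).symm)
      (Finset.mem_erase.2 ⟨Ne.symm h, Finset.mem_univ j⟩)

theorem mulVec_le_exitRate_mul (hQ : IsRateMatrix Q) (g : S → ℝ) (i : S) :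
    Q.mulVec g i ≤ exitRate Q i * ∑ j, |g j| := by
  rw [Finset.mul_sum]
  refine Finset.sum_le_sum fun j _ => (le_abs_self _).trans ?_
  rw [abs_mul]
  exact mul_le_mul_of_nonneg_right (hQ.abs_apply_le_exitRate i j) (abs_nonneg _)

theorem jumpMatrix_nonneg (hQ : IsRateMatrix Q) (i j : S) : 0 ≤ jumpMatrix Q i j := by
  rw [jumpMatrix, Matrix.of_apply]
  split_ifs with h
  · exact le_rfl
  · exact div_nonneg (hQ.nonneg_of_ne i j h) (hQ.exitRate_nonneg i)

end IsRateMatrix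

theorem mulVec_eq_exitRate_mul {Q : Matrix S S ℝ} {i : S} (hi : exitRate Q i ≠ 0) (g : S → ℝ) :
    Q.mulVec g i = exitRate Q i * ((jumpMatrix Q).mulVec g i - g i) := by
  have h : ∀ j, Q i j * g j =
      exitRate Q i * (jumpMatrix Q i j * g j) - exitRate Q i * (if j = i then g j else 0) := by
    intro j
    rw [jumpMatrix, Matrix.of_apply]
    by_cases hij : j = i
    · subst hij
      simp [exitRate]
    · rw [if_neg (Ne.symm hij), if_neg hij]
      field_simp
      ring
  simp only [Matrix.mulVec, dotProduct]
  rw [Finset.sum_congr rfl fun j _ => h j, Finset.sum_sub_distrib, ← Finset.mul_sum,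
    ← Finset.mul_sum, mul_sub]
  simp

theorem fastStates_union_slowStates {Q : ℝ → Matrix S S ℝ}
    (hQ : ∀ l : ℝ, 0 < l → IsRateMatrix (Q l))
    (hlim : ∀ i j, i ≠ j →
      (∃ c : ℝ, Tendsto (fun l => Q l i j) atTop (𝓝 c)) ∨
        Tendsto (fun l => Q l i j) atTop atTop) :
    fastStates Q ∪ slowStates Q = Finset.univ := by
  refine Finset.eq_univ_of_forall fun i => Finset.mem_union.2 ?_
  by_cases h : ∃ j, i ≠ j ∧ Tendsto (fun l => Q l i j) atTop atTop
  · obtain ⟨j, hij, hj⟩ := h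
    refine Or.inl (mem_fastStates.2 (tendsto_atTop_mono' atTop ?_ hj))
    filter_upwards [eventually_gt_atTop 0] with l hl
    exact (le_abs_self _).trans ((hQ l hl).abs_apply_le_exitRate i j)
  · have h' : ∀ j, ∃ c : ℝ, i ≠ j → Tendsto (fun l => Q l i j) atTop (𝓝 c) := by
      intro j
      by_cases hij : i = j
      · exact ⟨0, fun hne => absurd hij hne⟩
      · obtain ⟨c, hc⟩ := (hlim i j hij).resolve_right fun ht => h ⟨j, hij, ht⟩
        exact ⟨c, fun _ => hc⟩
    choose c hc using h'
    refine Or.inr (mem_slowStates.2 ⟨∑ j ∈ Finset.univ.erase i, c j, ?_⟩)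
    refine (tendsto_finsetSum (Finset.univ.erase i) fun j hj =>
      hc j (Finset.ne_of_mem_erase hj).symm).congr' ?_
    filter_upwards [eventually_gt_atTop 0] with l hl
    exact ((hQ l hl).exitRate_eq_sum i).symm

end Rates

section FastDynamics

variable {S : Type*} [Fintype S] [DecidableEq S] {Q : ℝ → Matrix S S ℝ} {Ω : Matrix S S ℝ}
  {t : ℝ → ℝ} {w : S → ℝ}

theorem tendsto_jumpMatrix_mulVec
    (hΩ : ∀ i j, Tendsto (fun l => jumpMatrix (Q l) i j) atTop (𝓝 (Ω i j))) (g : S → ℝ) (i : S) :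
    Tendsto (fun l => (jumpMatrix (Q l)).mulVec g i) atTop (𝓝 (Ω.mulVec g i)) :=
  tendsto_finsetSum _ fun j _ => (hΩ i j).mul_const _

/-- A nonnegative solution of `w - Ω w = 1` on the fast states that vanishes on the slow ones
decays to `0` on the time scale `t`. -/
theorem tendsto_exp_mulVec_zero (hQ : ∀ l : ℝ, 0 < l → IsRateMatrix (Q l))
    (hΩ : ∀ i j, Tendsto (fun l => jumpMatrix (Q l) i j) atTop (𝓝 (Ω i j)))
    (hAB : fastStates Q ∪ slowStates Q = Finset.univ)
    (htpos : ∀ l, 0 < l → 0 < t l) (ht : Tendsto t atTop (𝓝 0))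
    (htA : ∀ i ∈ fastStates Q, ∀ᶠ l in atTop, 1 ≤ exitRate (Q l) i * t l ^ 2)
    (hw0 : ∀ i, 0 ≤ w i) (hwB : ∀ i ∈ slowStates Q, w i = 0)
    (hwA : ∀ i ∈ fastStates Q, w i - Ω.mulVec w i = 1) (i : S) :
    Tendsto (fun l => (NormedSpace.exp (t l • Q l)).mulVec w i) atTop (𝓝 0) := by
  obtain ⟨C₀, hC₀, hC⟩ := exists_eventually_exitRate_le Q
  set W : ℝ := 1 + ∑ j, |w j| with hW
  have hWpos : 0 < W := by
    have : 0 ≤ ∑ j, |w j| := Finset.sum_nonneg fun j _ => abs_nonneg _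
    linarith
  have hwW : ∀ j, w j ≤ W := fun j => by
    have := Finset.single_le_sum (f := fun j => |w j|) (fun j _ => abs_nonneg _)
      (Finset.mem_univ j)
    linarith [le_abs_self (w j)]
  have hdrift : ∀ᶠ l in atTop, ∀ j ∈ fastStates Q,
      (jumpMatrix (Q l)).mulVec w j - w j ≤ -(1 / 2) := by
    refine (Finset.eventually_all _).2 fun j hj => ?_
    refine ((tendsto_jumpMatrix_mulVec hΩ w j).sub_const (w j)).eventually_le_const ?_
    linarith [hwA j hj]
  have hle : ∀ᶠ l in atTop, (NormedSpace.exp (t l • Q l)).mulVec w i ≤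
      Real.exp (-(1 / (2 * W) * (t l)⁻¹)) * w i + 2 * W * (C₀ * W) * t l ^ 2 := by
    filter_upwards [hC, hdrift, (Finset.eventually_all _).2 htA, eventually_gt_atTop 0]
      with l hCl hdl htl hl
    have htl0 := htpos l hl
    have hq : ∀ j, (Q l).mulVec w j ≤ C₀ * W - (1 / (2 * W * t l ^ 2)) * w j := by
      intro j
      rcases Finset.mem_union.1 (hAB ▸ Finset.mem_univ j) with hj | hj
      · have h1 := htl j hj
        have hpos : 0 < exitRate (Q l) j := by
          by_contra hneg
          nlinarith [sq_nonneg (t l)]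
        rw [mulVec_eq_exitRate_mul hpos.ne']
        have h2 := mul_le_mul_of_nonneg_left (hdl j hj) hpos.le
        have h3 : (1 / (2 * W * t l ^ 2)) * w j ≤ exitRate (Q l) j * (1 / 2) := by
          rw [one_div_mul_eq_div, div_le_iff₀ (by positivity)]
          nlinarith [hwW j]
        have h4 : 0 ≤ C₀ * W := by positivity
        linarith
      · rw [hwB j hj, mul_zero, sub_zero]
        refine ((hQ l hl).mulVec_le_exitRate_mul w j).trans ?_
        exact mul_le_mul (hCl j hj) (by linarith)
          (Finset.sum_nonneg fun j _ => abs_nonneg _) hC₀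
    have := (hQ l hl).exp_mulVec_le_of_drift (by positivity) (by positivity) hq htl0.le i
    convert this using 2
    · congr 3
      field_simp
    · field_simp
  have hinv : Tendsto (fun l => (t l)⁻¹) atTop atTop := by
    refine Tendsto.inv_tendsto_nhdsGT_zero (tendsto_nhdsWithin_iff.2 ⟨ht, ?_⟩)
    filter_upwards [eventually_gt_atTop 0] with l hl using htpos l hl
  have hexp : Tendsto (fun l => Real.exp (-(1 / (2 * W) * (t l)⁻¹))) atTop (𝓝 0) :=
    Real.tendsto_exp_neg_atTop_nhds_zero.comp (hinv.const_mul_atTop (by positivity))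
  have hlim := (hexp.mul_const (w i)).add ((ht.pow 2).const_mul (2 * W * (C₀ * W)))
  simp only [zero_mul, ne_eq, OfNat.ofNat_ne_zero, not_false_eq_true, zero_pow, mul_zero,
    add_zero] at hlim
  refine tendsto_of_tendsto_of_tendsto_of_le_of_le' tendsto_const_nhds hlim ?_ hle
  filter_upwards [eventually_gt_atTop 0] with l hl
  exact Finset.sum_nonneg fun j _ =>
    mul_nonneg ((hQ l hl).exp_apply_nonneg (htpos l hl).le i j) (hw0 j)

theorem eventually_exp_mulVec_le (hQ : ∀ l : ℝ, 0 < l → IsRateMatrix (Q l))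
    (hΩ : ∀ i j, Tendsto (fun l => jumpMatrix (Q l) i j) atTop (𝓝 (Ω i j)))
    (hAB : fastStates Q ∪ slowStates Q = Finset.univ)
    (htpos : ∀ l, 0 < l → 0 < t l) (ht : Tendsto t atTop (𝓝 0))
    (hw0 : ∀ i, 0 ≤ w i) (hwA : ∀ i ∈ fastStates Q, w i - Ω.mulVec w i = 1)
    {g : S → ℝ} (hg : ∀ i ∈ fastStates Q, Ω.mulVec g i = g i) (i : S) {ε : ℝ} (hε : 0 < ε) :
    ∀ᶠ l in atTop, (NormedSpace.exp (t l • Q l)).mulVec g i ≤ g i + ε := by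
  obtain ⟨C₀, hC₀, hC⟩ := exists_eventually_exitRate_le Q
  set δ : ℝ := ε / (2 * (1 + w i)) with hδ
  have hwi : 0 < 1 + w i := by linarith [hw0 i]
  have hδpos : 0 < δ := by positivity
  have hδw : δ * w i ≤ ε / 2 := by
    have : δ * (1 + w i) = ε / 2 := by rw [hδ]; field_simp
    linarith
  set u : S → ℝ := g + δ • w with hu
  have hdrift : ∀ᶠ l in atTop, ∀ j ∈ fastStates Q,
      0 < exitRate (Q l) j ∧ (jumpMatrix (Q l)).mulVec u j - u j ≤ 0 := by
    refine (Finset.eventually_all _).2 fun j hj =>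
      ((mem_fastStates.1 hj).eventually_gt_atTop 0).and ?_
    refine ((tendsto_jumpMatrix_mulVec hΩ u j).sub_const (u j)).eventually_le_const ?_
    have : Ω.mulVec u j - u j = -δ := by
      rw [hu, Matrix.mulVec_add, Matrix.mulVec_smul, Pi.add_apply, Pi.add_apply, Pi.smul_apply,
        Pi.smul_apply, hg j hj, smul_eq_mul, smul_eq_mul]
      linear_combination (-δ) * hwA j hj
    linarith
  set V : ℝ := ∑ j, |u j| with hV
  have hV0 : 0 ≤ V := Finset.sum_nonneg fun j _ => abs_nonneg _
  have hsmall : ∀ᶠ l in atTop, C₀ * V * t l ≤ ε / 2 := by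
    have := ht.const_mul (C₀ * V)
    rw [mul_zero] at this
    exact this.eventually_le_const (by linarith)
  filter_upwards [hC, hdrift, hsmall, eventually_gt_atTop 0] with l hCl hdl hsl hl
  have htl0 := htpos l hl
  have hq : ∀ j, (Q l).mulVec u j ≤ C₀ * V := by
    intro j
    rcases Finset.mem_union.1 (hAB ▸ Finset.mem_univ j) with hj | hj
    · obtain ⟨hpos, h1⟩ := hdl j hj
      rw [mulVec_eq_exitRate_mul hpos.ne']
      exact (mul_nonpos_of_nonneg_of_nonpos hpos.le h1).trans (by positivity)
    · exact ((hQ l hl).mulVec_le_exitRate_mul u j).trans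
        (mul_le_mul_of_nonneg_right (hCl j hj) hV0)
  have h1 := (hQ l hl).exp_mulVec_le_of_le hq htl0.le i
  have h2 := (hQ l hl).exp_mulVec_mono htl0.le (f := g) (g := u)
    (fun j => by simpa [hu] using mul_nonneg hδpos.le (hw0 j)) i
  have h3 : u i = g i + δ * w i := rfl
  linarith

/-- A function which is harmonic for `Ω` on the fast states is asymptotically preserved. -/
theorem tendsto_exp_mulVec_of_harmonic (hQ : ∀ l : ℝ, 0 < l → IsRateMatrix (Q l))
    (hΩ : ∀ i j, Tendsto (fun l => jumpMatrix (Q l) i j) atTop (𝓝 (Ω i j)))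
    (hAB : fastStates Q ∪ slowStates Q = Finset.univ)
    (htpos : ∀ l, 0 < l → 0 < t l) (ht : Tendsto t atTop (𝓝 0))
    (hw0 : ∀ i, 0 ≤ w i) (hwA : ∀ i ∈ fastStates Q, w i - Ω.mulVec w i = 1)
    {g : S → ℝ} (hg : ∀ i ∈ fastStates Q, Ω.mulVec g i = g i) (i : S) :
    Tendsto (fun l => (NormedSpace.exp (t l • Q l)).mulVec g i) atTop (𝓝 (g i)) := by
  rw [Metric.tendsto_nhds]
  intro ε hε
  have hneg : ∀ i ∈ fastStates Q, Ω.mulVec (-g) i = (-g) i := fun j hj => by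
    rw [Matrix.mulVec_neg, Pi.neg_apply, Pi.neg_apply, hg j hj]
  filter_upwards [eventually_exp_mulVec_le hQ hΩ hAB htpos ht hw0 hwA hg i (half_pos hε),
    eventually_exp_mulVec_le hQ hΩ hAB htpos ht hw0 hwA hneg i (half_pos hε)] with l h1 h2
  rw [Matrix.mulVec_neg, Pi.neg_apply, Pi.neg_apply] at h2
  rw [Real.dist_eq, abs_lt]
  constructor <;> linarith

theorem tendsto_exp_apply_of_harmonic (hQ : ∀ l : ℝ, 0 < l → IsRateMatrix (Q l))
    (hΩ : ∀ i j, Tendsto (fun l => jumpMatrix (Q l) i j) atTop (𝓝 (Ω i j)))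
    (hAB : fastStates Q ∪ slowStates Q = Finset.univ)
    (htpos : ∀ l, 0 < l → 0 < t l) (ht : Tendsto t atTop (𝓝 0))
    (htA : ∀ i ∈ fastStates Q, ∀ᶠ l in atTop, 1 ≤ exitRate (Q l) i * t l ^ 2)
    (hw0 : ∀ i, 0 ≤ w i) (hwB : ∀ i ∈ slowStates Q, w i = 0)
    (hw1 : ∀ i ∈ fastStates Q, 1 ≤ w i)
    (hwA : ∀ i ∈ fastStates Q, w i - Ω.mulVec w i = 1)
    {g : S → ℝ} (hg : ∀ i ∈ fastStates Q, Ω.mulVec g i = g i) {j : S}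
    (hgB : ∀ i ∈ slowStates Q, g i = (Pi.single j 1 : S → ℝ) i) (i : S) :
    Tendsto (fun l => NormedSpace.exp (t l • Q l) i j) atTop (𝓝 (g i)) := by
  set e : S → ℝ := Pi.single j 1 with he
  set c : ℝ := ∑ k, |g k - e k| with hc
  have hc0 : 0 ≤ c := Finset.sum_nonneg fun k _ => abs_nonneg _
  have hbound : ∀ k, |g k - e k| ≤ c * w k := by
    intro k
    rcases Finset.mem_union.1 (hAB ▸ Finset.mem_univ k) with hk | hk
    · have h1 : |g k - e k| ≤ c := Finset.single_le_sum (f := fun k => |g k - e k|)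
        (fun k _ => abs_nonneg _) (Finset.mem_univ k)
      nlinarith [hw1 k hk]
    · rw [hgB k hk, hwB k hk]
      simp
  have hG := tendsto_exp_mulVec_of_harmonic hQ hΩ hAB htpos ht hw0 hwA hg i
  have hW := (tendsto_exp_mulVec_zero hQ hΩ hAB htpos ht htA hw0 hwB hwA i).const_mul c
  rw [mul_zero] at hW
  have hlo := hG.sub hW
  have hhi := hG.add hW
  rw [sub_zero] at hlo
  rw [add_zero] at hhi
  have hent : ∀ l, NormedSpace.exp (t l • Q l) i j = (NormedSpace.exp (t l • Q l)).mulVec e i := by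
    intro l
    rw [he, Matrix.mulVec_single_one]
    rfl
  have hmono : ∀ᶠ l in atTop,
      (NormedSpace.exp (t l • Q l)).mulVec g i - c * (NormedSpace.exp (t l • Q l)).mulVec w i ≤
        NormedSpace.exp (t l • Q l) i j ∧
      NormedSpace.exp (t l • Q l) i j ≤
        (NormedSpace.exp (t l • Q l)).mulVec g i +
          c * (NormedSpace.exp (t l • Q l)).mulVec w i := by
    filter_upwards [eventually_gt_atTop 0] with l hl
    have h1 := (hQ l hl).exp_mulVec_mono (htpos l hl).le (f := g - c • w) (g := e)
      (fun k => by
        simp only [Pi.sub_apply, Pi.smul_apply, smul_eq_mul]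
        linarith [(abs_le.1 (hbound k)).2]) i
    have h2 := (hQ l hl).exp_mulVec_mono (htpos l hl).le (f := e) (g := g + c • w)
      (fun k => by
        simp only [Pi.add_apply, Pi.smul_apply, smul_eq_mul]
        linarith [(abs_le.1 (hbound k)).1]) i
    rw [Matrix.mulVec_sub, Matrix.mulVec_smul] at h1
    rw [Matrix.mulVec_add, Matrix.mulVec_smul] at h2
    rw [hent]
    exact ⟨h1, h2⟩
  exact tendsto_of_tendsto_of_tendsto_of_le_of_le' hlo hhi (hmono.mono fun l h => h.1)
    (hmono.mono fun l h => h.2)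

theorem exists_time_scale {S : Type*} [Fintype S] (Q : ℝ → Matrix S S ℝ) :
    ∃ t : ℝ → ℝ≥0, (∀ l : ℝ, 0 < l → 0 < t l) ∧ Tendsto t atTop (𝓝 0) ∧
      ∀ i ∈ fastStates Q, ∀ᶠ l in atTop, 1 ≤ exitRate (Q l) i * (t l : ℝ) ^ 2 := by
  let s : ℝ → ℝ := fun l => l⁻¹ + ∑ i ∈ fastStates Q, (√(exitRate (Q l) i))⁻¹
  have hs : ∀ l, 0 < l → 0 < s l := fun l hl =>
    add_pos_of_pos_of_nonneg (inv_pos.2 hl) (Finset.sum_nonneg fun i _ => by positivity)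
  refine ⟨fun l => (s l).toNNReal, fun l hl => Real.toNNReal_pos.2 (hs l hl), ?_,
    fun i hi => ?_⟩
  · have h : Tendsto s atTop (𝓝 (0 + ∑ i ∈ fastStates Q, 0)) :=
      tendsto_inv_atTop_zero.add (tendsto_finsetSum _ fun i hi =>
        tendsto_inv_atTop_zero.comp (Real.tendsto_sqrt_atTop.comp (mem_fastStates.1 hi)))
    simp only [Finset.sum_const_zero, add_zero] at h
    simpa using tendsto_real_toNNReal h
  · filter_upwards [eventually_gt_atTop 0, (mem_fastStates.1 hi).eventually_gt_atTop 0]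
      with l hl hq
    rw [Real.coe_toNNReal _ (hs l hl).le]
    have h1 : (√(exitRate (Q l) i))⁻¹ ≤ s l := by
      have := Finset.single_le_sum (f := fun i => (√(exitRate (Q l) i))⁻¹)
        (fun i _ => by positivity) hi
      have h2 : 0 < l⁻¹ := inv_pos.2 hl
      simp only [s]
      linarith
    calc (1 : ℝ) = exitRate (Q l) i * (√(exitRate (Q l) i))⁻¹ ^ 2 := by
          rw [inv_pow, Real.sq_sqrt hq.le, mul_inv_cancel₀ hq.ne']
      _ ≤ exitRate (Q l) i * s l ^ 2 := by gcongr

end FastDynamics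

section Assembly

variable {S : Type*} [DecidableEq S] {A B : Finset S} {Ω : Matrix S S ℝ}

/-- The law on `S` at which the jump chain with transition matrix `Ω`, started in `i`, hits
`B`. -/
noncomputable def hittingMatrix (Ω : Matrix S S ℝ) (A B : Finset S) : Matrix S S ℝ :=
  Matrix.of fun i j =>
    if hj : j ∈ B then
      if hi : i ∈ A then ((1 - block Ω A A)⁻¹ * block Ω A B) ⟨i, hi⟩ ⟨j, hj⟩
      else (Pi.single j 1 : S → ℝ) i
    else 0

theorem hittingMatrix_of_mem (hd : Disjoint A B) {i : S} (hi : i ∈ B) (j : S) :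
    hittingMatrix Ω A B i j = (Pi.single j 1 : S → ℝ) i := by
  have hiA : i ∉ A := Finset.disjoint_right.1 hd hi
  by_cases hj : j ∈ B
  · simp [hittingMatrix, hj, hiA]
  · have : i ≠ j := fun h => hj (h ▸ hi)
    simp [hittingMatrix, hj, this]

/-- The expected number of visits to `A` of the chain with transition matrix `Ω`. -/
noncomputable def expectedVisits (Ω : Matrix S S ℝ) (A : Finset S) (i : S) : ℝ :=
  if hi : i ∈ A then (1 - block Ω A A)⁻¹.mulVec 1 ⟨i, hi⟩ else 0

theorem one_le_expectedVisits (hM : ∀ i j, 0 ≤ block Ω A A i j)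
    (h : Tendsto (fun n : ℕ => block Ω A A ^ n) atTop (𝓝 0)) {i : S} (hi : i ∈ A) :
    1 ≤ expectedVisits Ω A i := by
  rw [expectedVisits, dif_pos hi]
  calc (1 : ℝ) = (1 : Matrix A A ℝ).mulVec 1 ⟨i, hi⟩ := by rw [Matrix.one_mulVec]; rfl
    _ ≤ _ := Finset.sum_le_sum fun j _ =>
      mul_le_mul_of_nonneg_right (Matrix.one_apply_le_inv_one_sub hM h _ j) zero_le_one

variable [Fintype S]

theorem sum_eq_sum_subtype_add (hd : Disjoint A B) (hu : A ∪ B = Finset.univ)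
    (f : S → ℝ) : ∑ i, f i = ∑ a : A, f a + ∑ b : B, f b := by
  rw [← hu, Finset.sum_union hd, ← Finset.sum_coe_sort A, ← Finset.sum_coe_sort B]

theorem mulVec_hittingMatrix (hd : Disjoint A B) (hu : A ∪ B = Finset.univ)
    (hunit : IsUnit (1 - block Ω A A)) {i : S} (hi : i ∈ A) (j : S) :
    Ω.mulVec (fun k => hittingMatrix Ω A B k j) i = hittingMatrix Ω A B i j := by
  by_cases hj : j ∈ B
  · have hdet := (Matrix.isUnit_iff_isUnit_det _).1 hunit
    have hN : block Ω A A * ((1 - block Ω A A)⁻¹ * block Ω A B) + block Ω A B =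
        (1 - block Ω A A)⁻¹ * block Ω A B := by
      have h := Matrix.mul_nonsing_inv_cancel_left _ (block Ω A B) hdet
      rw [Matrix.sub_mul, Matrix.one_mul, sub_eq_iff_eq_add'] at h
      exact h.symm
    have hij := congrFun (congrFun hN ⟨i, hi⟩) ⟨j, hj⟩
    rw [Matrix.mulVec, dotProduct, sum_eq_sum_subtype_add hd hu]
    have hB : ∑ b : B, Ω i b * hittingMatrix Ω A B b j = Ω i j := by
      rw [Finset.sum_eq_single ⟨j, hj⟩]
      · simp [hittingMatrix_of_mem hd hj]
      · intro b _ hb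
        have : (b : S) ≠ j := fun h => hb (Subtype.ext h)
        simp [hittingMatrix_of_mem hd b.2, this]
      · simp
    have hA : hittingMatrix Ω A B i j =
        ((1 - block Ω A A)⁻¹ * block Ω A B) ⟨i, hi⟩ ⟨j, hj⟩ := by
      simp [hittingMatrix, hi, hj]
    rw [hB, hA, ← hij, Matrix.add_apply, Matrix.mul_apply]
    congr 1
    refine Finset.sum_congr rfl fun a _ => ?_
    simp [hittingMatrix, hj, block]
  · simp [hittingMatrix, hj, Matrix.mulVec, dotProduct]

theorem gammaDist_eq_sum (hd : Disjoint A B) (hu : A ∪ B = Finset.univ) (π : S → ℝ) (j : S) :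
    gammaDist Ω A B π j = ∑ i, π i * hittingMatrix Ω A B i j := by
  by_cases hj : j ∈ B
  · have hB : ∑ b : B, π b * hittingMatrix Ω A B b j = π j := by
      rw [Finset.sum_eq_single ⟨j, hj⟩]
      · simp [hittingMatrix_of_mem hd hj]
      · intro b _ hb
        have : (b : S) ≠ j := fun h => hb (Subtype.ext h)
        simp [hittingMatrix_of_mem hd b.2, this]
      · simp
    rw [sum_eq_sum_subtype_add hd hu, hB, gammaDist, dif_pos hj, add_comm, Matrix.vecMul,
      dotProduct]
    congr 1
    refine Finset.sum_congr rfl fun a _ => ?_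
    simp [hittingMatrix, hj]
  · simp [gammaDist, hittingMatrix, hj]

theorem expectedVisits_sub_mulVec (hunit : IsUnit (1 - block Ω A A)) {i : S} (hi : i ∈ A) :
    expectedVisits Ω A i - Ω.mulVec (expectedVisits Ω A) i = 1 := by
  have hdet := (Matrix.isUnit_iff_isUnit_det _).1 hunit
  have h : (1 - block Ω A A).mulVec ((1 - block Ω A A)⁻¹.mulVec 1) = 1 := by
    rw [Matrix.mulVec_mulVec, Matrix.mul_nonsing_inv _ hdet, Matrix.one_mulVec]
  rw [Matrix.sub_mulVec, Matrix.one_mulVec] at h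
  have hi' := congrFun h ⟨i, hi⟩
  rw [Pi.sub_apply, Pi.one_apply] at hi'
  rw [← hi']
  congr 1
  · simp [expectedVisits, hi]
  · rw [Matrix.mulVec, dotProduct, sum_eq_sum_subtype_add (B := Aᶜ) disjoint_compl_right
      (Finset.union_compl A), Matrix.mulVec, dotProduct]
    have hB : ∑ b : (Aᶜ : Finset S), Ω i b * expectedVisits Ω A b = 0 :=
      Finset.sum_eq_zero fun b _ => by
        rw [expectedVisits, dif_neg (Finset.mem_compl.1 b.2), mul_zero]
    rw [hB, add_zero]
    refine Finset.sum_congr rfl fun a _ => ?_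
    simp [expectedVisits, block]

theorem IsMarkovChain.law_eq {E : Type*} [MeasurableSpace E] {P : Measure E}
    {X : ℝ≥0 → E → S} {Q : Matrix S S ℝ} {π : S → ℝ} (h : IsMarkovChain P X Q π) (t : ℝ≥0)
    (j : S) : law P (X t) j = ∑ i, π i * NormedSpace.exp ((t : ℝ) • Q) i j := by
  have := h.isProbabilityMeasure
  have hset : X t ⁻¹' {j} =
      ⋃ i ∈ (Finset.univ : Finset S), (X 0 ⁻¹' {i} ∩ X t ⁻¹' {j}) := by
    ext x
    simp
  rw [law, hset, measureReal_biUnion_finset]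
  · refine Finset.sum_congr rfl fun i _ => ?_
    have hp := h.measure_path 1 ![0, t]
      (by intro a b hab; fin_cases a <;> fin_cases b <;> simp_all) rfl ![i, j]
    have hs : {x | ∀ k : Fin 2, X ((![0, t] : Fin 2 → ℝ≥0) k) x = (![i, j] : Fin 2 → S) k} =
        X 0 ⁻¹' {i} ∩ X t ⁻¹' {j} := by
      ext x
      simp [Fin.forall_fin_two]
    rw [← hs]
    refine hp.trans ?_
    simp
  · intro a _ b _ hab
    exact Set.disjoint_left.2 fun x hx hy => hab (hx.1.symm.trans hy.1)
  · exact fun i _ => (h.measurableSet_preimage 0 i).inter (h.measurableSet_preimage t j)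

end Assembly

theorem corollary3 {S : Type*} [Fintype S] [DecidableEq S]
    -- the rate matrices
    (Q : ℝ → Matrix S S ℝ)
    (hQ : ∀ l : ℝ, 0 < l → IsRateMatrix (Q l))
    (hirr : ∀ l : ℝ, 0 < l → IsIrreducibleRate (Q l))
    (hlim : ∀ i j, i ≠ j →
      (∃ c : ℝ, Tendsto (fun l => Q l i j) atTop (𝓝 c)) ∨
        Tendsto (fun l => Q l i j) atTop atTop)
    -- the limit of the jump matrices
    (Ω : Matrix S S ℝ)
    (hΩ : ∀ i j, Tendsto (fun l => jumpMatrix (Q l) i j) atTop (𝓝 (Ω i j)))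
    -- there are slow states, and their limiting exit rates are positive
    (hne : (slowStates Q).Nonempty)
    (hpos : ∀ i ∈ slowStates Q, ∀ c : ℝ,
      Tendsto (fun l => exitRate (Q l) i) atTop (𝓝 c) → 0 < c)
    -- the chain with transition matrix `Ω` reaches the slow states from every fast state
    {H : Type*} [MeasurableSpace H] (R : S → Measure H) (η : ℕ → H → S)
    (hη : ∀ i, IsDiscreteMarkovChain (R i) η Ω (Pi.single i 1))
    (hT : ∀ i ∈ fastStates Q, ∀ᵐ x ∂(R i), firstPassageTime η (slowStates Q) x < ⊤)
    -- the initial distribution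
    (π : S → ℝ) (hπ : π ∈ stdSimplex ℝ S) :
    IsUnit (1 - block Ω (fastStates Q) (fastStates Q)) ∧
    gammaDist Ω (fastStates Q) (slowStates Q) π ∈ stdSimplex ℝ S ∧
    ∀ ε : ℝ, 0 < ε → ∃ t : ℝ → ℝ≥0,
      (∀ l : ℝ, 0 < l → 0 < t l) ∧
      Tendsto t atTop (𝓝 0) ∧
      ∀ᶠ l in atTop, ∀ (E : Type*) [MeasurableSpace E] (P : Measure E) (X : ℝ≥0 → E → S),
        IsMarkovChain P X (Q l) π →
          dTV (law P (X (t l))) (gammaDist Ω (fastStates Q) (slowStates Q) π) ≤ ε := by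
  set A := fastStates Q with hA
  set B := slowStates Q with hB
  have hd : Disjoint A B := disjoint_fastStates_slowStates Q
  have hu : A ∪ B = Finset.univ := fastStates_union_slowStates hQ hlim
  have hΩ0 : ∀ i j, 0 ≤ Ω i j := fun i j => ge_of_tendsto (hΩ i j) <| by
    filter_upwards [eventually_gt_atTop 0] with l hl using (hQ l hl).jumpMatrix_nonneg i j
  have hM0 : ∀ i j, 0 ≤ block Ω A A i j := fun i j => hΩ0 i j
  have hpow := Matrix.tendsto_pow_of_mulVec_one hM0 fun i =>
    (hη i).tendsto_block_pow_mulVec_one i hd (hT i i.2)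
  have hunit := Matrix.isUnit_one_sub_of_tendsto_pow hpow
  have hw1 : ∀ i ∈ A, 1 ≤ expectedVisits Ω A i := fun i hi => one_le_expectedVisits hM0 hpow hi
  have hw0 : ∀ i, 0 ≤ expectedVisits Ω A i := by
    intro i
    by_cases hi : i ∈ A
    · exact zero_le_one.trans (hw1 i hi)
    · rw [expectedVisits, dif_neg hi]
  have hwB : ∀ i ∈ B, expectedVisits Ω A i = 0 := fun i hi => by
    rw [expectedVisits, dif_neg (Finset.disjoint_right.1 hd hi)]
  obtain ⟨t, htpos, ht, htA⟩ := exists_time_scale Q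
  have htR : Tendsto (fun l => (t l : ℝ)) atTop (𝓝 0) :=
    NNReal.tendsto_coe.2 ht
  have hconv : ∀ i j, Tendsto (fun l => NormedSpace.exp ((t l : ℝ) • Q l) i j) atTop
      (𝓝 (hittingMatrix Ω A B i j)) := fun i j =>
    tendsto_exp_apply_of_harmonic (t := fun l => (t l : ℝ)) hQ hΩ hu (fun l hl => htpos l hl) htR
      htA hw0 hwB hw1 (fun i hi => expectedVisits_sub_mulVec hunit hi)
      (g := fun k => hittingMatrix Ω A B k j)
      (fun i hi => mulVec_hittingMatrix hd hu hunit hi j)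
      (fun i hi => hittingMatrix_of_mem hd hi j) i
  have hF0 : ∀ i j, 0 ≤ hittingMatrix Ω A B i j := fun i j => ge_of_tendsto (hconv i j) <| by
    filter_upwards [eventually_gt_atTop 0] with l hl using
      (hQ l hl).exp_apply_nonneg (t l).2 i j
  have hF1 : ∀ i, ∑ j, hittingMatrix Ω A B i j = 1 := fun i =>
    tendsto_nhds_unique_of_eventuallyEq (tendsto_finsetSum _ fun j _ => hconv i j)
      tendsto_const_nhds <| by
        filter_upwards [eventually_gt_atTop 0] with l hl
        simpa [Matrix.mulVec, dotProduct] using (hQ l hl).exp_mulVec_const (t l) 1 i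
  refine ⟨hunit, ⟨fun j => ?_, ?_⟩, fun ε hε => ⟨t, htpos, ht, ?_⟩⟩
  · rw [gammaDist_eq_sum hd hu]
    exact Finset.sum_nonneg fun i _ => mul_nonneg (hπ.1 i) (hF0 i j)
  · simp_rw [gammaDist_eq_sum hd hu]
    rw [Finset.sum_comm]
    simp_rw [← Finset.mul_sum, hF1, mul_one]
    exact hπ.2
  · have hdTV : Tendsto (fun l => dTV
        (fun j => ∑ i, π i * NormedSpace.exp ((t l : ℝ) • Q l) i j) (gammaDist Ω A B π))
        atTop (𝓝 0) := by
      have h : Tendsto (fun l => dTV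
          (fun j => ∑ i, π i * NormedSpace.exp ((t l : ℝ) • Q l) i j) (gammaDist Ω A B π))
          atTop (𝓝 ((1 / 2) * ∑ j, |gammaDist Ω A B π j - gammaDist Ω A B π j|)) := by
        refine (tendsto_finsetSum _ fun j _ => ?_).const_mul _
        refine (Tendsto.sub_const ?_ _).abs
        rw [gammaDist_eq_sum hd hu]
        exact tendsto_finsetSum _ fun i _ => (hconv i j).const_mul _
      simpa using h
    filter_upwards [hdTV.eventually_le_const hε] with l hl E _ P X hX
    rwa [show law P (X (t l)) = _ from funext fun j => hX.law_eq (t l) j]
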